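/- Let $\mathbf{Cat}$ be the category of small categories and functors. Call a functor $F : A \to B$ between small categories 1. a cofibration if it is injective on objects; 2. a weak equivalence (groupoidal equivalence) if, for every small groupoid $Z$, the precomposition functor $F^* : [B, Z] \to [A, Z]$ between functor categories is an equivalence of categories; 3. a fibration (path fibration) if it has the right lifting property with respect to all functors that are both cofibrations and weak equivalences. Then these classes form a model structure on $\mathbf{Cat}$ (the groupoidal model structure), and it is cartesian closed: the terminal category is cofibrant and, for all cofibrations $u : C \to D$ and $i : X \to Y$, the pushout product $$u \mathbin{\Box} i : (D \times X) \coprod_{C \times X} (C \times Y) \longrightarrow D \times Y$$ is a cofibration, which is a weak equivalence if $u$ or $i$ is a weak equivalence. -/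

import Mathlib

open CategoryTheory HomotopicalAlgebra

universe u

namespace GroupoidalCat

/-- The cofibrations: functors that are injective on objects. -/
def cof : MorphismProperty Cat.{u, u} := fun _ _ F =>
  Function.Injective F.toFunctor.obj

/-- The weak equivalences (groupoidal equivalences): functors `F : A ⥤ B` such that, for every
groupoid `Z`, precomposition with `F` is an equivalence of functor categories
`(B ⥤ Z) ⥤ (A ⥤ Z)`. -/
def weq : MorphismProperty Cat.{u, u} := fun A B F =>
  ∀ (Z : Type u) [Groupoid.{u} Z],
    ((Functor.whiskeringLeft A B Z).obj F.toFunctor).IsEquivalence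

/-- The fibrations (path fibrations): functors with the right lifting property with respect to
all functors that are both cofibrations and weak equivalences. -/
def fib : MorphismProperty Cat.{u, u} := (cof.{u} ⊓ weq.{u}).rlp

end GroupoidalCat

/-- A model structure on a cartesian closed category `C` is cartesian closed if the terminal
object is cofibrant and the pushout product `B × X ⨿_{A × X} A × Y ⟶ B × Y` of two cofibrations
`f : A ⟶ B` and `g : X ⟶ Y` is a cofibration which is acyclic as soon as `f` or `g` is acyclic.
In `Functor.PushoutObjObj`, the pushout is any pushout of `A ⊗ X ⟶ B ⊗ X` and
`A ⊗ X ⟶ A ⊗ Y`, and `sq.ι` is the map to `B ⊗ Y` that it induces. -/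
structure IsCartesianClosedModelCategory (C : Type*) [Category C] [CartesianMonoidalCategory C]
    [MonoidalClosed C] [ModelCategory C] : Prop where
  isCofibrant_unit : IsCofibrant (MonoidalCategoryStruct.tensorUnit C)
  cofibration_pushoutProduct {A B X Y : C} (f : A ⟶ B) (g : X ⟶ Y)
    (sq : (MonoidalCategory.curriedTensor C).PushoutObjObj f g) :
    Cofibration f → Cofibration g → Cofibration sq.ι
  weakEquivalence_pushoutProduct_left {A B X Y : C} (f : A ⟶ B) (g : X ⟶ Y)
    (sq : (MonoidalCategory.curriedTensor C).PushoutObjObj f g) :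
    Cofibration f → Cofibration g → WeakEquivalence f → WeakEquivalence sq.ι
  weakEquivalence_pushoutProduct_right {A B X Y : C} (f : A ⟶ B) (g : X ⟶ Y)
    (sq : (MonoidalCategory.curriedTensor C).PushoutObjObj f g) :
    Cofibration f → Cofibration g → WeakEquivalence g → WeakEquivalence sq.ι

/-! Retracts, two-out-of-three and tensoring are formal, since a weak equivalence is defined by
precomposition. The substance is the factorization into a trivial cofibration and a path fibration.
Let `R : B ⥤ K` be the map to the free groupoid and `G : H ⥤ K` the map of free groupoids induced by
`f : A ⟶ B`. Then `f` factors through the comma category of `G` and `R`. Its projection to `B` is a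
path fibration (`fib_snd`): functors into the groupoids `H` and `K` extend along a trivial
cofibration up to isomorphism, and injectivity on objects makes the filler strict. Its projection to
`H` is a groupoidal equivalence (`weq_fst`), hence so is the map from `A`, which is then made
injective on objects.

For `weq_fst`, functors from the comma category to a groupoid `Z` are encoded as functors from `B`
to a groupoid `Fam G Z` over `K`, whose fiber over `k` is the category of functors from
`CostructuredArrow G k` to `Z`. As `R` is a groupoidal equivalence, it can be tested against both
`Fam G Z` and `K`.

The other factorization uses surjective equivalences, and lifting follows by the retract argument.
The pushout product is handled by counting objects, cobase change and two-out-of-three. -/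

namespace CategoryTheory.Functor

/-! ### Equivalences under retracts, and strict lifts -/

section

variable {A B A' B' : Type*} [Category* A] [Category* B] [Category* A'] [Category* B']

/-- A functor which is a retract, up to isomorphisms, of an equivalence is an equivalence. -/
lemma isEquivalence_of_retract {F : A ⥤ B} (G : A' ⥤ B') [G.IsEquivalence]
    (iA : A ⥤ A') (rA : A' ⥤ A) (iB : B ⥤ B') (rB : B' ⥤ B)
    (eA : iA ⋙ rA ≅ 𝟭 A) (eB : iB ⋙ rB ≅ 𝟭 B) (ei : iA ⋙ G ≅ F ⋙ iB) (er : rA ⋙ F ≅ G ⋙ rB) :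
    F.IsEquivalence :=
  Functor.IsEquivalence.mk' (iB ⋙ G.inv ⋙ rA)
    (eA.symm ≪≫ isoWhiskerLeft iA ((leftUnitor _).symm ≪≫
        isoWhiskerRight G.asEquivalence.unitIso rA ≪≫ associator _ _ _) ≪≫
      (associator _ _ _).symm ≪≫ isoWhiskerRight ei _ ≪≫ associator _ _ _)
    (isoWhiskerLeft iB (associator _ _ _ ≪≫ isoWhiskerLeft G.inv er ≪≫
      (associator _ _ _).symm ≪≫ isoWhiskerRight G.asEquivalence.counitIso rB ≪≫
        leftUnitor _) ≪≫ eB)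

end

section

variable {C D P Q : Type*} [Category* C] [Category* D] [Category* P] [Category* Q]

/-- If `i` is injective on objects, a diagonal filler of a square whose upper triangle commutes
up to an isomorphism over the identity can be replaced by a strict filler. -/
lemma exists_strict_lift {i : C ⥤ D} (hi : Function.Injective i.obj) {t : C ⥤ P} {p : P ⥤ Q}
    {d : D ⥤ Q} (h : D ⥤ P) (hp : h ⋙ p = d) (e : i ⋙ h ≅ t)
    (w : ∀ c, p.obj (h.obj (i.obj c)) = p.obj (t.obj c))
    (he : ∀ c, p.map (e.hom.app c) = eqToHom (w c)) :
    ∃ h' : D ⥤ P, i ⋙ h' = t ∧ h' ⋙ p = d := by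
  subst hp
  -- Keep `h` off the image of `i` and move it along `e` on the image; injectivity of `i` makes this
  -- choice unambiguous.
  have key (x : D) : ∃ (y : P) (φ : h.obj x ≅ y) (hy : p.obj (h.obj x) = p.obj y),
      p.map φ.hom = eqToHom hy ∧ ∀ (c : C) (hc : x = i.obj c), ∃ hy' : t.obj c = y,
        φ.hom = eqToHom (by rw [hc]; rfl) ≫ e.hom.app c ≫ eqToHom hy' := by
    by_cases hx : ∃ c, x = i.obj c
    · obtain ⟨c, rfl⟩ := hx
      refine ⟨t.obj c, e.app c, w c, he c, fun c' hc' ↦ ?_⟩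
      obtain rfl := hi hc'
      exact ⟨rfl, by simp⟩
    · exact ⟨h.obj x, Iso.refl _, rfl, by simp, fun c hc ↦ (hx ⟨c, hc⟩).elim⟩
  choose y φ hy hφ hc using key
  refine ⟨h.copyObj y φ, ?_, ?_⟩
  · refine Functor.ext_of_iso (isoWhiskerLeft i (h.isoCopyObj y φ).symm ≪≫ e)
      (fun c ↦ ((hc _ c rfl).1).symm) (fun c ↦ ?_)
    obtain ⟨h₁, h₂⟩ := hc _ c rfl
    change (φ (i.obj c)).inv ≫ e.hom.app c = eqToHom h₁.symm
    rw [Iso.inv_comp_eq, h₂]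
    simp
  · refine (Functor.ext_of_iso (isoWhiskerRight (h.isoCopyObj y φ) p) (fun x ↦ hy x)
      (fun x ↦ ?_)).symm
    exact hφ x

/-- Fully faithful functors which are surjective on objects have the right lifting property
with respect to functors which are injective on objects. -/
lemma exists_lift_of_fullyFaithful {i : C ⥤ D} (hi : Function.Injective i.obj) {t : C ⥤ P}
    {p : P ⥤ Q} [p.Full] [p.Faithful] (hp : Function.Surjective p.obj) {d : D ⥤ Q}
    (w : t ⋙ p = i ⋙ d) : ∃ h : D ⥤ P, i ⋙ h = t ∧ h ⋙ p = d := by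
  choose s hs using hp
  -- A strict section of `p`. The candidate `d ⋙ σ` agrees with `t` along `i` only up to an
  -- isomorphism over `Q`, which `exists_strict_lift` then removes.
  let σ : Q ⥤ P :=
    { obj := s
      map {X Y} f := p.preimage (eqToHom (hs X) ≫ f ≫ eqToHom (hs Y).symm)
      map_id X := p.map_injective (by simp)
      map_comp f g := p.map_injective (by simp) }
  have hσ : σ ⋙ p = 𝟭 Q := Functor.ext_of_iso
    (NatIso.ofComponents (fun X ↦ eqToIso (hs X)) (by simp [σ])) (fun X ↦ hs X) (fun _ ↦ rfl)
  refine exists_strict_lift hi (d ⋙ σ) (p := p) (d := d) (t := t)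
    (by rw [Functor.assoc, hσ, Functor.comp_id])
    (NatIso.ofComponents (fun c ↦ p.preimageIso
      (eqToIso ((hs _).trans (Functor.congr_obj w c).symm))) ?_) ?_ ?_
  · intro c c' f
    apply p.map_injective
    have := Functor.congr_hom w f
    dsimp at this
    simp [σ, this]
  · intro c
    exact (hs _).trans (Functor.congr_obj w c).symm
  · intro c
    simp

end

end CategoryTheory.Functor

/-! ### Closure properties and surjective equivalences -/

namespace GroupoidalCat

open Functor

instance : weq.{u}.HasTwoOutOfThreeProperty where
  comp_mem f g hf hg Z _ := by
    have := hf Z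
    have := hg Z
    exact inferInstanceAs (((whiskeringLeft _ _ Z).obj g.toFunctor ⋙
      (whiskeringLeft _ _ Z).obj f.toFunctor).IsEquivalence)
  of_postcomp f g hg hfg Z _ := by
    have := hg Z
    have : ((whiskeringLeft _ _ Z).obj g.toFunctor ⋙
      (whiskeringLeft _ _ Z).obj f.toFunctor).IsEquivalence := hfg Z
    exact isEquivalence_of_comp_left ((whiskeringLeft _ _ Z).obj g.toFunctor) _
  of_precomp f g hf hfg Z _ := by
    have := hf Z
    have : ((whiskeringLeft _ _ Z).obj g.toFunctor ⋙
      (whiskeringLeft _ _ Z).obj f.toFunctor).IsEquivalence := hfg Z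
    exact isEquivalence_of_comp_right _ ((whiskeringLeft _ _ Z).obj f.toFunctor)

/-- The isomorphism of composites of precomposition functors given by a commutative square. -/
def whiskeringLeftIsoOfEq {A B C B' : Cat.{u, u}} {f : A ⟶ B} {g : B ⟶ C}
    {f' : A ⟶ B'} {g' : B' ⟶ C}
    (h : f ≫ g = f' ≫ g') (Z : Type u) [Category.{u} Z] :
    (whiskeringLeft _ _ Z).obj g.toFunctor ⋙ (whiskeringLeft _ _ Z).obj f.toFunctor ≅
      (whiskeringLeft _ _ Z).obj g'.toFunctor ⋙ (whiskeringLeft _ _ Z).obj f'.toFunctor :=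
  (whiskeringLeft A C Z).mapIso (eqToIso congr(($h).toFunctor))

instance : weq.{u}.IsStableUnderRetracts where
  of_retract {A B A' B' f g} h hg Z _ := by
    have := hg Z
    exact isEquivalence_of_retract ((whiskeringLeft _ _ Z).obj g.toFunctor)
      ((whiskeringLeft _ _ Z).obj h.r.right.toFunctor)
      ((whiskeringLeft _ _ Z).obj h.i.right.toFunctor)
      ((whiskeringLeft _ _ Z).obj h.r.left.toFunctor)
      ((whiskeringLeft _ _ Z).obj h.i.left.toFunctor)
      (whiskeringLeftIsoOfEq (f' := 𝟙 _) (g' := 𝟙 _) (by simp) Z)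
      (whiskeringLeftIsoOfEq (f' := 𝟙 _) (g' := 𝟙 _) (by simp) Z)
      (whiskeringLeftIsoOfEq (by simp) Z)
      (whiskeringLeftIsoOfEq (by simp) Z)

instance : cof.{u}.IsStableUnderRetracts where
  of_retract {A B A' B' f g} h hg x y hxy := by
    have h₁ (z : A) : h.r.left.toFunctor.obj (h.i.left.toFunctor.obj z) = z :=
      Functor.congr_obj congr(($(h.retract_left)).toFunctor) z
    have h₂ (z : A) : g.toFunctor.obj (h.i.left.toFunctor.obj z) =
        h.i.right.toFunctor.obj (f.toFunctor.obj z) :=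
      Functor.congr_obj congr(($(h.i.w)).toFunctor) z
    rw [← h₁ x, ← h₁ y, hg ((h₂ x).trans (by rw [hxy, h₂]))]

instance : fib.{u}.IsStableUnderRetracts := by
  dsimp [fib]
  infer_instance

lemma weq_of_isEquivalence {A B : Cat.{u, u}} (F : A ⟶ B) [F.toFunctor.IsEquivalence] : weq F :=
  fun _ _ ↦ inferInstance

/-- The full and faithful functors which are surjective on objects. -/
def surjEquiv : MorphismProperty Cat.{u, u} := fun _ _ F ↦
  F.toFunctor.Full ∧ F.toFunctor.Faithful ∧ Function.Surjective F.toFunctor.obj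

lemma surjEquiv_le_weq : surjEquiv.{u} ≤ weq := fun _ _ F ⟨_, _, h⟩ ↦ by
  have : F.toFunctor.EssSurj := ⟨fun Y ↦ ⟨_, ⟨eqToIso (h Y).choose_spec⟩⟩⟩
  have : F.toFunctor.IsEquivalence := { }
  exact weq_of_isEquivalence F

lemma surjEquiv_le_rlp : surjEquiv.{u} ≤ cof.rlp := fun X Y p ⟨_, _, hp⟩ A B i hi ↦ by
  refine ⟨fun {t d} sq ↦ ?_⟩
  obtain ⟨l, h₁, h₂⟩ := exists_lift_of_fullyFaithful hi (t := t.toFunctor) hp (d := d.toFunctor)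
    congr(($(sq.w)).toFunctor)
  exact ⟨⟨⟨⟨l⟩, Cat.ext h₁, Cat.ext h₂⟩⟩⟩

lemma surjEquiv_le_fib : surjEquiv.{u} ≤ fib :=
  surjEquiv_le_rlp.trans (MorphismProperty.antitone_rlp inf_le_left)

/-- The middle category has objects `A ⊕ B` and all its morphisms come from `B`: the left summand
gives injectivity, the right one surjectivity. -/
instance : cof.{u}.HasFactorization surjEquiv where
  nonempty_mapFactorizationData {A B} f :=
    let e : A ⊕ B → B := Sum.elim f.toFunctor.obj id
    let i : A ⥤ InducedCategory B e :=
      { obj := fun a ↦ Sum.inl a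
        map g := ⟨f.toFunctor.map g⟩
        map_id a := InducedCategory.hom_ext (f.toFunctor.map_id a)
        map_comp g h := InducedCategory.hom_ext (f.toFunctor.map_comp g h) }
    ⟨{  Z := Cat.of (InducedCategory B e)
        i := ⟨i⟩
        p := ⟨inducedFunctor e⟩
        fac := rfl
        hi := Sum.inl_injective
        hp := ⟨InducedCategory.full e, InducedCategory.faithful e, fun b ↦ ⟨Sum.inr b, rfl⟩⟩ }⟩

/-! ### The groupoid of families over `K` -/

section

variable {H K B Z : Type u}

section

variable [Category.{u} H] [Category.{u} K] [Category.{u} Z]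

/-- For a functor `G : H ⥤ K`, an object of `K` together with a family of objects of `Z`
indexed by the category of objects of `H` over it. -/
structure Fam (G : H ⥤ K) (Z : Type u) [Category.{u} Z] where
  /-- the object of `K` -/
  pt : K
  /-- the family of objects of `Z` -/
  fam : CostructuredArrow G pt ⥤ Z

namespace Fam

variable {G : H ⥤ K}

/-- A morphism of families lying over a morphism `base` of `K`: a natural family of morphisms
of `Z` indexed by the morphisms of `H` which lie over `base`. -/
structure Hom (X Y : Fam G Z) where
  /-- the morphism in `K` -/
  base : X.pt ⟶ Y.pt
  /-- the family of morphisms in `Z` -/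
  app {x : CostructuredArrow G X.pt} {y : CostructuredArrow G Y.pt} (v : x.left ⟶ y.left)
    (hv : G.map v ≫ y.hom = x.hom ≫ base) : X.fam.obj x ⟶ Y.fam.obj y
  map_app {x' x : CostructuredArrow G X.pt} {y : CostructuredArrow G Y.pt} (a : x' ⟶ x)
    (v : x.left ⟶ y.left) (hv : G.map v ≫ y.hom = x.hom ≫ base) :
    X.fam.map a ≫ app v hv = app (a.left ≫ v) (by simp [hv])
  app_map {x : CostructuredArrow G X.pt} {y y' : CostructuredArrow G Y.pt}
    (v : x.left ⟶ y.left) (hv : G.map v ≫ y.hom = x.hom ≫ base) (b : y ⟶ y') :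
    app v hv ≫ Y.fam.map b = app (v ≫ b.left) (by simp [hv])

lemma Hom.ext' {X Y : Fam G Z} {f g : Hom X Y} (h : f.base = g.base)
    (h' : ∀ {x : CostructuredArrow G X.pt} {y : CostructuredArrow G Y.pt} (v : x.left ⟶ y.left)
      (hv : G.map v ≫ y.hom = x.hom ≫ f.base) (hv' : G.map v ≫ y.hom = x.hom ≫ g.base),
      f.app v hv = g.app v hv') : f = g := by
  obtain ⟨b, f, _, _⟩ := f
  obtain ⟨b', g, _, _⟩ := g
  obtain rfl : b = b' := h
  congr
  funext x y v hv
  exact h' v hv hv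

lemma Hom.app_congr {X Y : Fam G Z} {f g : Hom X Y} (h : f = g) {x : CostructuredArrow G X.pt}
    {y : CostructuredArrow G Y.pt} {v v' : x.left ⟶ y.left} (h' : v = v')
    (hv : G.map v ≫ y.hom = x.hom ≫ f.base) :
    f.app v hv = g.app v' (by rw [← h, ← h', hv]) := by
  subst h h'
  rfl

/-- The identity of a family. -/
def Hom.id (X : Fam G Z) : Hom X X where
  base := 𝟙 X.pt
  app v hv := X.fam.map (CostructuredArrow.homMk v (by simpa using hv))
  map_app a v hv := by
    rw [← X.fam.map_comp]
    congr 1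
  app_map v hv b := by
    rw [← X.fam.map_comp]
    congr 1

/-- The composition of morphisms of families. -/
def Hom.comp {X Y W : Fam G Z} (f : Hom X Y) (g : Hom Y W) : Hom X W where
  base := f.base ≫ g.base
  -- Of all factorizations of `v`, the canonical one through `x` pushed forward along `f.base` is
  -- used; `comp_app` shows that any other gives the same result.
  app {x y} v hv := f.app (y := CostructuredArrow.mk (x.hom ≫ f.base)) (𝟙 x.left) (by simp) ≫
    g.app (x := CostructuredArrow.mk (x.hom ≫ f.base)) v (by simpa using hv)
  map_app {x' x y} a v hv := by
    have h₁ := f.map_app a (y := CostructuredArrow.mk (x.hom ≫ f.base)) (𝟙 x.left) (by simp)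
    have h₂ := f.app_map (x := x') (y := CostructuredArrow.mk (x'.hom ≫ f.base)) (𝟙 x'.left)
      (by simp) (y' := CostructuredArrow.mk (x.hom ≫ f.base))
      (CostructuredArrow.homMk a.left (by simp))
    have h₃ := g.map_app (x' := CostructuredArrow.mk (x'.hom ≫ f.base))
      (x := CostructuredArrow.mk (x.hom ≫ f.base)) (CostructuredArrow.homMk a.left (by simp)) v
      (by simpa using hv)
    simp only [CostructuredArrow.homMk_left, Category.comp_id, Category.id_comp] at h₁ h₂ h₃
    rw [reassoc_of% h₁, ← h₃, reassoc_of% h₂]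
  app_map v hv b := by
    rw [Category.assoc, g.app_map]

lemma Hom.comp_app {X Y W : Fam G Z} (f : Hom X Y) (g : Hom Y W) {x : CostructuredArrow G X.pt}
    {y : CostructuredArrow G Y.pt} {w : CostructuredArrow G W.pt} {v : x.left ⟶ y.left}
    {v' : y.left ⟶ w.left} (hv : G.map v ≫ y.hom = x.hom ≫ f.base)
    (hv' : G.map v' ≫ w.hom = y.hom ≫ g.base) (v'' : x.left ⟶ w.left) (h : v ≫ v' = v'')
    (hv'' : G.map v'' ≫ w.hom = x.hom ≫ (f.comp g).base) :
    (f.comp g).app v'' hv'' = f.app v hv ≫ g.app v' hv' := by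
  subst h
  have h₁ := f.app_map (x := x) (y := CostructuredArrow.mk (x.hom ≫ f.base)) (𝟙 x.left)
    (by simp) (y' := y) (CostructuredArrow.homMk v (by simpa using hv))
  have h₂ := g.map_app (x' := CostructuredArrow.mk (x.hom ≫ f.base)) (x := y)
    (CostructuredArrow.homMk v (by simpa using hv)) v' hv'
  simp only [CostructuredArrow.homMk_left, Category.id_comp] at h₁ h₂
  rw [← h₁, Category.assoc, h₂]
  rfl

instance : Category (Fam G Z) where
  Hom := Hom
  id := Hom.id
  comp := Hom.comp
  id_comp {X Y} f := Hom.ext' (Category.id_comp _) (fun {x y} v hv hv' ↦ by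
    rw [Hom.comp_app (Hom.id X) f (y := x) (v := 𝟙 _) (by simp [Hom.id]) hv' v
      (Category.id_comp _)]
    exact (f.map_app _ _ _).trans (Hom.app_congr rfl (Category.id_comp _) _))
  comp_id {X Y} f := Hom.ext' (Category.comp_id _) (fun {x y} v hv hv' ↦ by
    rw [Hom.comp_app f (Hom.id Y) (y := y) (v' := 𝟙 _) hv' (by simp [Hom.id]) v
      (Category.comp_id _)]
    exact (f.app_map _ _ _).trans (Hom.app_congr rfl (Category.comp_id _) _))
  assoc {X Y W V} f g h := Hom.ext' (Category.assoc _ _ _) (fun {x y} v hv hv' ↦ by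
    have h₀ : G.map v ≫ y.hom = ((x.hom ≫ f.base) ≫ g.base) ≫ h.base := by
      simpa [Hom.comp] using hv'
    have e₁ := Hom.comp_app f g (x := x) (y := CostructuredArrow.mk (x.hom ≫ f.base))
      (w := CostructuredArrow.mk ((x.hom ≫ f.base) ≫ g.base)) (v := 𝟙 x.left) (v' := 𝟙 x.left)
      (by simp) (by simp) (𝟙 x.left) (Category.id_comp _) (by simp [Hom.comp])
    have e₂ := Hom.comp_app g h (x := CostructuredArrow.mk (x.hom ≫ f.base))
      (y := CostructuredArrow.mk ((x.hom ≫ f.base) ≫ g.base)) (v := 𝟙 x.left) (v' := v)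
      (by simp) h₀ v (Category.id_comp _) (by simpa [Hom.comp] using h₀)
    refine (Hom.comp_app (f.comp g) h (y := CostructuredArrow.mk ((x.hom ≫ f.base) ≫ g.base))
      (v := 𝟙 x.left) (by simp [Hom.comp]) (v' := v) h₀ v (Category.id_comp _) _).trans ?_
    refine Eq.trans ?_ (Hom.comp_app f (g.comp h) (y := CostructuredArrow.mk (x.hom ≫ f.base))
      (v := 𝟙 x.left) (by simp) (v' := v) (by simpa [Hom.comp] using h₀) v
      (Category.id_comp _) _).symm
    refine (congrArg (· ≫ h.app v h₀) e₁).trans ((Category.assoc _ _ _).trans ?_)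
    exact (congrArg (f.app _ _ ≫ ·) e₂.symm))

@[ext]
lemma hom_ext {X Y : Fam G Z} {f g : X ⟶ Y} (h : f.base = g.base)
    (h' : ∀ {x : CostructuredArrow G X.pt} {y : CostructuredArrow G Y.pt} (v : x.left ⟶ y.left)
      (hv : G.map v ≫ y.hom = x.hom ≫ f.base) (hv' : G.map v ≫ y.hom = x.hom ≫ g.base),
      f.app v hv = g.app v hv') : f = g :=
  Hom.ext' h h'

@[simp]
lemma id_base (X : Fam G Z) : Hom.base (𝟙 X) = 𝟙 X.pt := rfl

@[simp]
lemma comp_base {X Y W : Fam G Z} (f : X ⟶ Y) (g : Y ⟶ W) :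
    (f ≫ g).base = f.base ≫ g.base := rfl

lemma app_comp_app {X Y W : Fam G Z} (f : X ⟶ Y) (g : Y ⟶ W) {x : CostructuredArrow G X.pt}
    {y : CostructuredArrow G Y.pt} {w : CostructuredArrow G W.pt} (v : x.left ⟶ y.left)
    (v' : y.left ⟶ w.left) (hv : G.map v ≫ y.hom = x.hom ≫ f.base)
    (hv' : G.map v' ≫ w.hom = y.hom ≫ g.base) :
    f.app v hv ≫ g.app v' hv' = (f ≫ g).app (v ≫ v') (by simp [hv', reassoc_of% hv]) :=
  (Hom.comp_app f g hv hv' _ rfl _).symm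

lemma app_congr {X Y : Fam G Z} {f g : X ⟶ Y} (h : f = g) {x : CostructuredArrow G X.pt}
    {y : CostructuredArrow G Y.pt} {v v' : x.left ⟶ y.left} (h' : v = v')
    (hv : G.map v ≫ y.hom = x.hom ≫ f.base) :
    f.app v hv = g.app v' (by rw [← h, ← h', hv]) :=
  Hom.app_congr h h' hv

lemma app_comm {X Y Y' W : Fam G Z} {f : X ⟶ Y} {g : Y ⟶ W} {f' : X ⟶ Y'} {g' : Y' ⟶ W}
    (h : f ≫ g = f' ≫ g') {x : CostructuredArrow G X.pt} {y : CostructuredArrow G Y.pt}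
    {y' : CostructuredArrow G Y'.pt} {w : CostructuredArrow G W.pt} {v₁ : x.left ⟶ y.left}
    {v₂ : y.left ⟶ w.left} {v₃ : x.left ⟶ y'.left} {v₄ : y'.left ⟶ w.left}
    (h' : v₁ ≫ v₂ = v₃ ≫ v₄)
    (h₁ : G.map v₁ ≫ y.hom = x.hom ≫ f.base) (h₂ : G.map v₂ ≫ w.hom = y.hom ≫ g.base)
    (h₃ : G.map v₃ ≫ y'.hom = x.hom ≫ f'.base) (h₄ : G.map v₄ ≫ w.hom = y'.hom ≫ g'.base) :
    f.app v₁ h₁ ≫ g.app v₂ h₂ = f'.app v₃ h₃ ≫ g'.app v₄ h₄ := by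
  rw [app_comp_app, app_comp_app]
  exact app_congr h h' _

variable (G Z) in
/-- The functor which forgets the families. -/
@[simps]
def proj : Fam G Z ⥤ K where
  obj X := X.pt
  map f := f.base

end Fam

end

section

variable [Groupoid.{u} H] [Groupoid.{u} K] [Groupoid.{u} Z] [Category.{u} B]

namespace Fam

variable {G : H ⥤ K}

/-- The inverse of a morphism of families. -/
noncomputable def Hom.inverse {X Y : Fam G Z} (f : Hom X Y) : Hom Y X where
  base := inv f.base
  app v hv := inv (f.app (inv v) (by rw [← cancel_epi (G.map v), reassoc_of% hv]; simp))
  map_app {x' x y} a v hv := by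
    have hv' : G.map v ≫ y.hom ≫ f.base = x.hom := by rw [← Category.assoc, hv]; simp
    have h : G.map (inv (a.left ≫ v)) ≫ x'.hom = y.hom ≫ f.base := by
      rw [← cancel_epi (G.map (a.left ≫ v))]
      simp [hv']
    rw [← IsIso.inv_eq_inv, IsIso.inv_comp, IsIso.inv_inv, IsIso.inv_inv, IsIso.comp_inv_eq,
      f.app_map _ h]
    exact Hom.app_congr rfl (by simp) _
  app_map {x y y'} v hv b := by
    have hv' : G.map v ≫ y.hom ≫ f.base = x.hom := by rw [← Category.assoc, hv]; simp
    have h : G.map (inv (v ≫ b.left)) ≫ x.hom = y'.hom ≫ f.base := by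
      rw [← cancel_epi (G.map (v ≫ b.left))]
      simp [hv']
    rw [← IsIso.inv_eq_inv, IsIso.inv_comp, IsIso.inv_inv, IsIso.inv_inv, IsIso.inv_comp_eq,
      f.map_app _ _ h]
    exact Hom.app_congr rfl (by simp) _

noncomputable instance : Groupoid (Fam G Z) where
  inv := Hom.inverse
  inv_comp {X Y} f := by
    refine hom_ext (IsIso.inv_hom_id (f.base)) (fun {x y} v hv hv' ↦ ?_)
    have h : G.map v ≫ y.hom = x.hom := by simpa using hv'
    refine (Hom.comp_app (Hom.inverse f) f
      (y := CostructuredArrow.mk (x.hom ≫ inv f.base)) (v := 𝟙 x.left) (v' := v)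
      (by simp [Hom.inverse]) (by simpa using h) v (Category.id_comp _) hv).trans ?_
    exact (IsIso.inv_comp_eq _).2 ((Hom.app_congr rfl (by simp) _).trans
      (f.app_map (x := CostructuredArrow.mk (x.hom ≫ inv f.base)) (y := x) (inv (𝟙 x.left))
        (by simp) (CostructuredArrow.homMk v h)).symm)
  comp_inv {X Y} f := by
    refine hom_ext (IsIso.hom_inv_id (f.base)) (fun {x y} v hv hv' ↦ ?_)
    have h : G.map v ≫ y.hom = x.hom := by simpa using hv'
    refine (Hom.comp_app f (Hom.inverse f) (y := CostructuredArrow.mk (x.hom ≫ f.base))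
      (v := 𝟙 x.left) (v' := v) (by simp) (by simpa [Hom.inverse] using h) v
      (Category.id_comp _) hv).trans ?_
    exact (IsIso.comp_inv_eq _).2 ((Hom.app_congr rfl (by simp) _).trans
      (f.map_app (y := CostructuredArrow.mk (x.hom ≫ f.base)) (CostructuredArrow.homMk v h)
        (inv v) (by simp [← h])).symm)

end Fam

end

end

/-! ### Functors on comma categories as families -/

namespace Fam

section

variable {H K B Z : Type u} [Category.{u} H] [Category.{u} K] [Category.{u} Z] [Category.{u} B]
variable {G : H ⥤ K}

variable (G) in
/-- The inclusion of the fiber of the projection from a comma category. -/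
@[simps]
def fiberInclusion (R : B ⥤ K) (b : B) : CostructuredArrow G (R.obj b) ⥤ Comma G R where
  obj x := { left := x.left, right := b, hom := x.hom }
  map a := { left := a.left, right := 𝟙 b, w := by simp }

/-- The family over `K` which corresponds to a functor from a comma category. -/
def ofComma {R : B ⥤ K} (T : Comma G R ⥤ Z) : B ⥤ Fam G Z where
  obj b :=
    { pt := R.obj b
      fam := fiberInclusion G R b ⋙ T }
  map {b b'} w :=
    { base := R.map w
      app {x y} v hv := T.map (X := (fiberInclusion G R b).obj x)
        (Y := (fiberInclusion G R b').obj y) { left := v, right := w, w := hv }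
      map_app _ _ _ := (T.map_comp _ _).symm.trans
        (congrArg T.map (CommaMorphism.ext rfl (Category.id_comp w)))
      app_map _ _ _ := (T.map_comp _ _).symm.trans
        (congrArg T.map (CommaMorphism.ext rfl (Category.comp_id w))) }
  map_id b := hom_ext (R.map_id b) (fun _ _ _ ↦ rfl)
  map_comp w w' := hom_ext (R.map_comp w w') (fun {x y} v hv hv' ↦ by
    refine Eq.trans ?_ (T.map_comp (X := (fiberInclusion G R _).obj x)
      (Y := (fiberInclusion G R _).obj (CostructuredArrow.mk (x.hom ≫ R.map w)))
      (Z := (fiberInclusion G R _).obj y)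
      { left := 𝟙 x.left, right := w, w := ?_ } { left := v, right := w', w := ?_ })
    · exact congrArg T.map (CommaMorphism.ext (Category.id_comp v).symm rfl)
    · exact (congrArg (· ≫ (x.hom ≫ R.map w)) (G.map_id x.left)).trans (Category.id_comp _)
    · exact hv'.trans (Category.assoc _ _ _).symm)

/-- The restriction to `H` of the total family which corresponds to a lift `S` of the identity
of `K`, up to a natural transformation `γ`. -/
def restrict (S : K ⥤ Fam G Z) (γ : ∀ k, k ⟶ (S.obj k).pt)
    (hγ : ∀ ⦃k k' : K⦄ (w : k ⟶ k'), w ≫ γ k' = γ k ≫ (S.map w).base) : H ⥤ Z where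
  obj h := (S.obj (G.obj h)).fam.obj (CostructuredArrow.mk (γ (G.obj h)))
  map u := (S.map (G.map u)).app u (hγ (G.map u))
  map_id h := (app_congr (g := 𝟙 _) (by simp) rfl _).trans
    ((S.obj (G.obj h)).fam.map_id (CostructuredArrow.mk (γ (G.obj h))))
  map_comp {h h' h''} u v := by
    refine (app_congr (g := S.map (G.map u) ≫ S.map (G.map v)) (by simp) rfl _).trans
      (app_comp_app _ _ (y := CostructuredArrow.mk (γ (G.obj h'))) _ _ ?_ ?_).symm
    · exact hγ (G.map u)
    · exact hγ (G.map v)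

/-- The family over `K` given by the restrictions of a functor on `H`. -/
def const (G : H ⥤ K) (F : H ⥤ Z) : K ⥤ Fam G Z where
  obj k := { pt := k, fam := CostructuredArrow.proj G k ⋙ F }
  map w :=
    { base := w
      app v hv := F.map v
      map_app _ _ _ := (F.map_comp _ _).symm
      app_map _ _ _ := (F.map_comp _ _).symm }
  map_id _ := rfl
  map_comp w w' := hom_ext rfl (fun v _ _ ↦ by
    refine Eq.trans ?_ (F.map_comp _ _)
    exact congrArg F.map (Category.id_comp v).symm)

/-- The morphism of families given by the restriction of a natural transformation. -/
def constMap (G : H ⥤ K) {F F' : H ⥤ Z} (β : F ⟶ F') : const G F ⟶ const G F' where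
  app k :=
    { base := 𝟙 k
      app {x y} v hv := F.map v ≫ β.app y.left
      map_app a v _ := (F.map_comp_assoc a.left v _).symm
      app_map v _ a := by
        refine (Category.assoc _ _ _).trans ?_
        refine (congrArg (F.map v ≫ ·) (β.naturality a.left).symm).trans ?_
        exact (F.map_comp_assoc v a.left _).symm }
  naturality k k' w := by
    refine hom_ext ((Category.comp_id w).trans (Category.id_comp w).symm)
      (fun {x y} v hv hv' ↦ ?_)
    change F.map (𝟙 _) ≫ F.map v ≫ β.app _ = (F.map (𝟙 _) ≫ β.app _) ≫ F'.map v
    simp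

/-- The morphism of families which corresponds to a natural transformation on a comma category. -/
def commaMap {R : B ⥤ K} {F F' : H ⥤ Z} (α : Comma.fst G R ⋙ F ⟶ Comma.fst G R ⋙ F') :
    R ⋙ const G F ⟶ R ⋙ const G F' where
  app b :=
    { base := 𝟙 (R.obj b)
      app {x y} v hv := F.map v ≫ α.app ((fiberInclusion G R b).obj y)
      map_app a v _ := (F.map_comp_assoc a.left v _).symm
      app_map v _ a := by
        refine (Category.assoc _ _ _).trans ?_
        refine (congrArg (F.map v ≫ ·) (α.naturality ((fiberInclusion G R b).map a)).symm).trans ?_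
        exact (F.map_comp_assoc v a.left _).symm }
  naturality b b' w := by
    refine hom_ext ((Category.comp_id _).trans (Category.id_comp _).symm)
      (fun {x y} v hv hv' ↦ ?_)
    let c : Comma G R := { left := x.left, right := b, hom := x.hom ≫ 𝟙 _ }
    let c' : Comma G R := { left := y.left, right := b', hom := y.hom }
    let m : c ⟶ c' := { left := v, right := w, w := by
                          refine hv'.trans ?_
                          exact (Category.assoc _ _ _).symm }
    have h : F.map v ≫ α.app c' = α.app c ≫ F'.map v := α.naturality m
    have h' : F.map (𝟙 c.left) ≫ F.map v ≫ α.app c' =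
        (F.map (𝟙 c.left) ≫ α.app c) ≫ F'.map v := by
      rw [h, Category.assoc]
    exact h'

end

end Fam

/-! ### The projection from the comma category is a groupoidal equivalence -/

section

open Fam

variable {H K B : Type u} [Groupoid.{u} H] [Groupoid.{u} K] [Category.{u} B]
variable (G : H ⥤ K) (R : B ⥤ K)

/-- `constMap G β` along `R` only involves `β` whiskered with the projection, while its component at
`𝟙 (G.obj h)` recovers `β.app h`. -/
lemma faithful_whiskeringLeft_fst (Z : Type u) [Groupoid.{u} Z]
    [((whiskeringLeft B K (Fam G Z)).obj R).Faithful] :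
    ((whiskeringLeft (Comma G R) H Z).obj (Comma.fst G R)).Faithful where
  map_injective {F F' β β'} hβ := by
    have h₁ : constMap G β = constMap G β' := by
      apply ((whiskeringLeft B K (Fam G Z)).obj R).map_injective
      ext b : 2
      refine hom_ext rfl (fun {x y} v hv hv' ↦ ?_)
      exact congrArg (F.map v ≫ ·)
        (NatTrans.congr_app hβ { left := y.left, right := b, hom := y.hom })
    ext h
    have h₂ := app_congr (NatTrans.congr_app h₁ (G.obj h))
      (x := CostructuredArrow.mk (𝟙 (G.obj h))) (y := CostructuredArrow.mk (𝟙 (G.obj h)))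
      (v := 𝟙 h) rfl ((congrArg (· ≫ 𝟙 _) (G.map_id h)))
    have h₃ : F.map (𝟙 h) ≫ β.app h = F.map (𝟙 h) ≫ β'.app h := h₂
    simpa using h₃

lemma full_whiskeringLeft_fst (Z : Type u) [Groupoid.{u} Z]
    [((whiskeringLeft B K K).obj R).Faithful]
    [((whiskeringLeft B K (Fam G Z)).obj R).Full] :
    ((whiskeringLeft (Comma G R) H Z).obj (Comma.fst G R)).Full where
  map_surjective {F F'} α := by
    obtain ⟨β, hβ⟩ := ((whiskeringLeft B K (Fam G Z)).obj R).map_surjective (commaMap (R := R) α)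
    -- The lift `β` might move base points; faithfulness of restriction along `R` for functors to
    -- `K` forces it to be vertical.
    have h₁ : whiskerRight β (proj Z G) = 𝟙 _ := by
      apply ((whiskeringLeft B K K).obj R).map_injective
      ext b
      exact congrArg Hom.base (NatTrans.congr_app hβ b)
    have h₂ (k : K) : (β.app k).base = 𝟙 k := NatTrans.congr_app h₁ k
    have h₃ {h : H} {k : K} (φ : G.obj h ⟶ k) :
        G.map (𝟙 h) ≫ φ = φ ≫ (β.app k).base := by
      rw [h₂]
      exact ((congrArg (· ≫ φ) (G.map_id h)).trans (Category.id_comp φ)).trans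
        (Category.comp_id φ).symm
    refine ⟨{
      app h := (β.app (G.obj h)).app (x := CostructuredArrow.mk (𝟙 (G.obj h)))
        (y := CostructuredArrow.mk (𝟙 (G.obj h))) (𝟙 h) (h₃ _)
      naturality h h' u := ?_ }, ?_⟩
    · exact app_comm (β.naturality (G.map u)) (x := CostructuredArrow.mk (𝟙 (G.obj h)))
        (y := CostructuredArrow.mk (𝟙 (G.obj h'))) (y' := CostructuredArrow.mk (𝟙 (G.obj h)))
        (w := CostructuredArrow.mk (𝟙 (G.obj h'))) (v₁ := u) (v₂ := 𝟙 h') (v₃ := 𝟙 h) (v₄ := u)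
        ((Category.comp_id _).trans (Category.id_comp _).symm)
        ((Category.comp_id _).trans (Category.id_comp _).symm) (h₃ _) (h₃ _)
        ((Category.comp_id _).trans (Category.id_comp _).symm)
    · ext c
      have hβc : β.app (R.obj c.right) = (commaMap (R := R) α).app c.right :=
        NatTrans.congr_app hβ c.right
      have h₄ : G.map (𝟙 c.left) ≫ c.hom = 𝟙 (G.obj c.left) ≫ c.hom :=
        congrArg (· ≫ c.hom) (G.map_id c.left)
      have h₅ : G.map (𝟙 c.left) ≫ c.hom = c.hom ≫ 𝟙 (R.obj c.right) :=
        h₄.trans ((Category.id_comp _).trans (Category.comp_id _).symm)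
      -- Naturality of `β` at `c.hom` carries its value at the identity of `G.obj c.left` to its
      -- value over `R.obj c.right`, which is `α.app c`.
      have e := app_comm ((congrArg ((Fam.const G F).map c.hom ≫ ·) hβc.symm).trans
          (β.naturality c.hom)) (x := CostructuredArrow.mk (𝟙 (G.obj c.left)))
        (y := CostructuredArrow.mk c.hom) (y' := CostructuredArrow.mk (𝟙 (G.obj c.left)))
        (w := CostructuredArrow.mk c.hom) (v₁ := 𝟙 c.left) (v₂ := 𝟙 c.left) (v₃ := 𝟙 c.left)
        (v₄ := 𝟙 c.left) rfl h₄ h₅ (h₃ _) h₄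
      have e₁ := (((Category.comp_id _).symm.trans (congrArg (_ ≫ ·) (F'.map_id c.left).symm)).trans
        e.symm).trans ((congrArg (· ≫ (F.map (𝟙 c.left) ≫ α.app c)) (F.map_id c.left)).trans
          ((Category.id_comp _).trans ((congrArg (· ≫ α.app c) (F.map_id c.left)).trans
            (Category.id_comp (α.app c)))))
      exact e₁

lemma essSurj_whiskeringLeft_fst (Z : Type u) [Groupoid.{u} Z]
    [((whiskeringLeft B K K).obj R).Full]
    [((whiskeringLeft B K (Fam G Z)).obj R).EssSurj] :
    ((whiskeringLeft (Comma G R) H Z).obj (Comma.fst G R)).EssSurj where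
  mem_essImage T := by
    obtain ⟨S, ⟨ε⟩⟩ := EssSurj.mem_essImage (F := (whiskeringLeft B K (Fam G Z)).obj R)
      (ofComma T)
    let ε₁ : ofComma T ⟶ R ⋙ S := ε.inv
    let ε₂ : R ⋙ S ⟶ ofComma T := ε.hom
    let δ : R ⋙ 𝟭 K ⟶ R ⋙ S ⋙ proj Z G :=
      { app b := (ε₁.app b).base
        naturality b b' w := congrArg Hom.base (ε₁.naturality w) }
    -- `S` need not be a section of `proj`. Fullness for functors to `K` extends the comparison `δ`
    -- from `B` to `K`, and `γ` selects the points at which `S` is evaluated in `restrict`.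
    obtain ⟨γ, hγ⟩ := ((whiskeringLeft B K K).obj R).map_surjective
      (X := 𝟭 K) (Y := S ⋙ proj Z G) δ
    have h₁ (b : B) : γ.app (R.obj b) ≫ (ε₂.app b).base = 𝟙 (R.obj b) := by
      have h₂ : γ.app (R.obj b) = (ε₁.app b).base := NatTrans.congr_app hγ b
      rw [h₂]
      exact congrArg Hom.base (NatTrans.congr_app ε.inv_hom_id b)
    have h₂ {k : K} {b : B} (φ : k ⟶ R.obj b) :
        γ.app k ≫ (S.map φ ≫ ε₂.app b).base = φ :=
      (Category.assoc _ _ _).symm.trans ((congrArg (· ≫ (ε₂.app b).base) (γ.naturality φ).symm).trans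
        ((Category.assoc _ _ _).trans ((congrArg (φ ≫ ·) (h₁ b)).trans (Category.comp_id φ))))
    have h₃ (c : Comma G R) : G.map (𝟙 c.left) ≫ c.hom =
        γ.app (G.obj c.left) ≫ (S.map c.hom ≫ ε₂.app c.right).base :=
      ((congrArg (· ≫ c.hom) (G.map_id c.left)).trans (Category.id_comp c.hom)).trans
        (h₂ c.hom).symm
    let τ : Comma.fst G R ⋙ restrict S γ.app @γ.naturality ⟶ T :=
      { app c := (S.map c.hom ≫ ε₂.app c.right).app
          (x := CostructuredArrow.mk (γ.app (G.obj c.left))) (y := CostructuredArrow.mk c.hom)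
          (𝟙 c.left) (h₃ c)
        naturality c c' m := by
          refine app_comm (f := S.map (G.map m.left)) (g := S.map c'.hom ≫ ε₂.app c'.right)
            (f' := S.map c.hom ≫ ε₂.app c.right) (g' := (ofComma T).map m.right) ?_
            (x := CostructuredArrow.mk (γ.app (G.obj c.left)))
            (y := CostructuredArrow.mk (γ.app (G.obj c'.left)))
            (y' := CostructuredArrow.mk c.hom) (w := CostructuredArrow.mk c'.hom)
            (v₁ := m.left) (v₂ := 𝟙 _) (v₃ := 𝟙 _) (v₄ := m.left)
            ((Category.comp_id _).trans (Category.id_comp _).symm)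
            (γ.naturality (G.map m.left)) (h₃ c') (h₃ c) m.w
          rw [Category.assoc, ← ε₂.naturality m.right, ← S.map_comp_assoc, m.w, S.map_comp_assoc]
          rfl }
    have (c : Comma G R) : IsIso (τ.app c) := inferInstanceAs (IsIso (C := Z) _)
    have : IsIso τ := NatIso.isIso_of_isIso_app τ
    exact ⟨restrict S γ.app @γ.naturality, ⟨asIso τ⟩⟩

/-- If `R` is a groupoidal equivalence to a groupoid, then so is the projection from a comma
category `Comma G R` where `G` is a functor between groupoids. -/
lemma weq_fst (hR : weq (Cat.Hom.ofFunctor R : Cat.of B ⟶ Cat.of K)) :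
    weq (Cat.Hom.ofFunctor (Comma.fst G R) : Cat.of (Comma G R) ⟶ Cat.of H) := fun Z _ ↦ by
  have h₁ : ((whiskeringLeft B K K).obj R).IsEquivalence := hR K
  have h₂ : ((whiskeringLeft B K (Fam G Z)).obj R).IsEquivalence := hR (Fam G Z)
  have := faithful_whiskeringLeft_fst G R Z
  have := full_whiskeringLeft_fst G R Z
  have := essSurj_whiskeringLeft_fst G R Z
  exact { faithful := ‹_›, full := ‹_›, essSurj := ‹_› }

end

/-! ### Path fibrations, factorizations and the model structure -/

/-- The projection from a comma category of functors to a groupoid, the first of which is a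
functor between groupoids, is a path fibration. -/
lemma fib_snd {H K B : Type u} [Groupoid.{u} H] [Groupoid.{u} K] [Category.{u} B]
    (G : H ⥤ K) (R : B ⥤ K) :
    fib (Cat.Hom.ofFunctor (Comma.snd G R) : Cat.of (Comma G R) ⟶ Cat.of B) := by
  rintro C D i ⟨hi, hi'⟩
  refine ⟨fun {t d} sq ↦ ?_⟩
  have w : t.toFunctor ⋙ Comma.snd G R = i.toFunctor ⋙ d.toFunctor := congr(($(sq.w)).toFunctor)
  obtain ⟨t⟩ := t
  obtain ⟨d⟩ := d
  obtain ⟨i⟩ := i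
  dsimp at w
  have h₁ : ((whiskeringLeft C D H).obj i).IsEquivalence := hi' H
  have h₂ : ((whiskeringLeft C D K).obj i).IsEquivalence := hi' K
  obtain ⟨l, ⟨e⟩⟩ := EssSurj.mem_essImage (F := (whiskeringLeft C D H).obj i) (t ⋙ Comma.fst G R)
  let e' : i ⋙ l ≅ t ⋙ Comma.fst G R := e
  let ω : t ⋙ Comma.snd G R ≅ i ⋙ d := eqToIso w
  -- The structure maps of `t`, transported to the extension `l`. Extending `α` along `i` provides
  -- the structure maps of a filler.
  let α : i ⋙ (l ⋙ G) ⟶ i ⋙ (d ⋙ R) :=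
    whiskerRight e'.hom G ≫ whiskerLeft t (Comma.natTrans G R) ≫ whiskerRight ω.hom R
  obtain ⟨β, hβ⟩ := ((whiskeringLeft C D K).obj i).map_surjective (X := l ⋙ G) (Y := d ⋙ R) α
  let h : D ⥤ Comma G R :=
    { obj x := { left := l.obj x, right := d.obj x, hom := β.app x }
      map f := { left := l.map f, right := d.map f, w := β.naturality f } }
  have hβ' (c : C) : β.app (i.obj c) = α.app c := NatTrans.congr_app hβ c
  have hα (c : C) : α.app c = G.map (e'.hom.app c) ≫ (t.obj c).hom ≫ R.map (ω.hom.app c) := rfl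
  -- The `B`-component of the isomorphism `i ⋙ h ≅ t` is an `eqToHom`, so it can be made strict
  -- without changing the projection `d`.
  obtain ⟨h', e₁, e₂⟩ := exists_strict_lift (p := Comma.snd G R) (d := d) hi h rfl
    (NatIso.ofComponents (fun c ↦ Comma.isoMk (e'.app c) (ω.symm.app c) (by
      change G.map (e'.hom.app c) ≫ (t.obj c).hom = β.app (i.obj c) ≫ R.map (ω.inv.app c)
      have hω : R.map (ω.hom.app c) ≫ R.map (ω.inv.app c) = 𝟙 _ := by
        rw [← R.map_comp, Iso.hom_inv_id_app, R.map_id]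
      rw [hβ', hα, Category.assoc, Category.assoc, hω]
      exact congrArg (G.map (e'.hom.app c) ≫ ·) (Category.comp_id (t.obj c).hom).symm))
      (fun {c c'} f ↦ by
        ext
        · exact e'.hom.naturality f
        · exact ω.inv.naturality f) : i ⋙ h ≅ t)
    (fun c ↦ (Functor.congr_obj w c).symm) (fun c ↦ eqToHom_app w.symm c)
  exact ⟨⟨⟨⟨h'⟩, Cat.ext e₁, Cat.ext e₂⟩⟩⟩

/-- The free groupoid is the localization at all morphisms, and every functor to a groupoid inverts
all of them. -/
lemma weq_freeGroupoid_of (A : Type u) [Category.{u} A] :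
    weq (Cat.Hom.ofFunctor (FreeGroupoid.of A) : Cat.of A ⟶ Cat.of (FreeGroupoid A)) :=
  fun Z _ ↦
    { full := Localization.full_whiskeringLeft (FreeGroupoid.of A) ⊤ Z
      faithful := Localization.faithful_whiskeringLeft (FreeGroupoid.of A) ⊤ Z
      essSurj := ⟨fun F ↦ ⟨FreeGroupoid.lift F, ⟨eqToIso (FreeGroupoid.lift_spec F)⟩⟩⟩ }

instance : fib.{u}.IsMultiplicative := by
  dsimp [fib]
  infer_instance

instance : (cof.{u} ⊓ weq.{u}).HasFactorization fib where
  nonempty_mapFactorizationData {A B} f := by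
    let G := FreeGroupoid.map f.toFunctor
    let R := FreeGroupoid.of B
    let j : A ⟶ Cat.of (Comma G R) := Cat.Hom.ofFunctor
      { obj a := { left := (FreeGroupoid.of A).obj a, right := f.toFunctor.obj a, hom := 𝟙 _ }
        map g := { left := (FreeGroupoid.of A).map g, right := f.toFunctor.map g, w := by
                    exact (Category.comp_id _).trans (Category.id_comp _).symm }
        map_id a := CommaMorphism.ext ((FreeGroupoid.of A).map_id a) (f.toFunctor.map_id a)
        map_comp g g' := CommaMorphism.ext ((FreeGroupoid.of A).map_comp g g')
          (f.toFunctor.map_comp g g') }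
    let p : Cat.of (Comma G R) ⟶ Cat.of (FreeGroupoid A) := Cat.Hom.ofFunctor (Comma.fst G R)
    let q : Cat.of (Comma G R) ⟶ B := Cat.Hom.ofFunctor (Comma.snd G R)
    -- `j ≫ p` is the canonical functor from `A` to its free groupoid.
    have hj : weq j := weq.of_postcomp j p (weq_fst G R (weq_freeGroupoid_of B))
      (weq_freeGroupoid_of A)
    let φ := MorphismProperty.factorizationData cof surjEquiv j
    refine ⟨{
      Z := φ.Z
      i := φ.i
      p := φ.p ≫ q
      fac := by rw [φ.fac_assoc]; rfl
      hi := ⟨φ.hi, weq.of_postcomp _ _ (surjEquiv_le_weq _ φ.hp) (φ.fac.symm ▸ hj)⟩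
      hp := MorphismProperty.comp_mem _ _ _ (surjEquiv_le_fib _ φ.hp) (fib_snd G R) }⟩

instance : cof.{u}.HasFactorization (fib ⊓ weq) where
  nonempty_mapFactorizationData f :=
    let φ := MorphismProperty.factorizationData cof surjEquiv f
    ⟨{ φ with hp := ⟨surjEquiv_le_fib _ φ.hp, surjEquiv_le_weq _ φ.hp⟩ }⟩

/-- Retract argument: in a factorization of `p` as a cofibration and a surjective equivalence, the
cofibration is trivial by two-out-of-three, so `p` lifts against it and is a retract of the
surjective equivalence. -/
lemma hasLiftingProperty_of_weq {A B X Y : Cat.{u, u}} (i : A ⟶ B) (p : X ⟶ Y) (hi : cof i)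
    (hp : fib p) (hp' : weq p) : HasLiftingProperty i p := by
  let φ := MorphismProperty.factorizationData cof surjEquiv p
  have : HasLiftingProperty φ.i p := hp _ ⟨φ.hi,
    weq.of_postcomp _ _ (surjEquiv_le_weq _ φ.hp) (φ.fac.symm ▸ hp')⟩
  exact (MorphismProperty.of_retract (RetractArrow.ofRightLiftingProperty φ.fac)
    (surjEquiv_le_rlp _ φ.hp)) i hi

/-- The groupoidal model structure. -/
@[reducible]
def modelCategory : ModelCategory Cat.{u, u} where
  categoryWithFibrations := ⟨fib⟩
  categoryWithCofibrations := ⟨cof⟩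
  categoryWithWeakEquivalences := ⟨weq⟩
  cm2 := inferInstanceAs weq.HasTwoOutOfThreeProperty
  cm3a := inferInstanceAs weq.IsStableUnderRetracts
  cm3b := inferInstanceAs fib.IsStableUnderRetracts
  cm3c := inferInstanceAs cof.IsStableUnderRetracts
  cm4a i p hi hi' hp := hp.mem i ⟨hi.mem, hi'.mem⟩
  cm4b i p hi hp hp' := hasLiftingProperty_of_weq i p hi.mem hp.mem hp'.mem
  cm5a := inferInstanceAs ((cof ⊓ weq).HasFactorization fib)
  cm5b := inferInstanceAs (cof.HasFactorization (fib ⊓ weq))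

/-! ### Pushout products -/

open MonoidalCategory

/-- Functors to the indiscrete category `E` on propositions are just predicates on objects. The
predicate of lying in one of the images and the constant predicate `True` agree on both legs, hence
everywhere. -/
lemma exists_obj_eq_of_isPushout {A B C P : Cat.{u, u}} {f : A ⟶ B} {g : A ⟶ C} {inl : B ⟶ P}
    {inr : C ⟶ P} (sq : IsPushout f g inl inr) (x : P) :
    (∃ b, inl.toFunctor.obj b = x) ∨ ∃ c, inr.toFunctor.obj c = x := by
  let E := InducedCategory (Discrete PUnit.{u + 1}) (fun _ : ULift.{u} Prop ↦ ⟨⟨⟩⟩)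
  have hE (y z : E) : Subsingleton (y ⟶ z) :=
    ⟨fun _ _ ↦ InducedCategory.hom_ext (Subsingleton.elim _ _)⟩
  let φ (χ : P → Prop) : P ⟶ Cat.of E := Cat.Hom.ofFunctor
    { obj y := ⟨χ y⟩
      map _ := ⟨𝟙 _⟩
      map_id _ := (hE _ _).elim _ _
      map_comp _ _ := (hE _ _).elim _ _ }
  let χ (y : P) : Prop := (∃ b, inl.toFunctor.obj b = y) ∨ ∃ c, inr.toFunctor.obj c = y
  have h : φ χ = φ (fun _ ↦ True) := by
    refine sq.hom_ext (Cat.ext (CategoryTheory.Functor.ext (fun b ↦ ?_)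
      fun _ _ _ ↦ (hE _ _).elim _ _))
      (Cat.ext (CategoryTheory.Functor.ext (fun c ↦ ?_) fun _ _ _ ↦ (hE _ _).elim _ _))
    · exact congrArg ULift.up (eq_true (Or.inl ⟨b, rfl⟩))
    · exact congrArg ULift.up (eq_true (Or.inr ⟨c, rfl⟩))
  exact of_eq_true (congrArg ULift.down (Functor.congr_obj congr(($h).toFunctor) x))

/-- By injectivity of `f` and `g`, the images of `B × X` and `A × Y` in `B × Y` meet only in objects
coming from `A × X`, and these are already identified in the pushout. -/
lemma cof_pushoutProduct {A B X Y : Cat.{u, u}} {f : A ⟶ B} {g : X ⟶ Y}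
    (sq : (curriedTensor Cat.{u, u}).PushoutObjObj f g) (hf : cof f) (hg : cof g) : cof sq.ι := by
  have hl (b : B) (x : X) : sq.ι.toFunctor.obj (sq.inl.toFunctor.obj (b, x)) =
      (b, g.toFunctor.obj x) :=
    Functor.congr_obj congr(($(sq.inl_ι)).toFunctor) ((b, x) : B × X)
  have hr (a : A) (y : Y) : sq.ι.toFunctor.obj (sq.inr.toFunctor.obj (a, y)) =
      (f.toFunctor.obj a, y) :=
    Functor.congr_obj congr(($(sq.inr_ι)).toFunctor) ((a, y) : A × Y)
  have hw (a : A) (x : X) : sq.inl.toFunctor.obj (f.toFunctor.obj a, x) =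
      sq.inr.toFunctor.obj (a, g.toFunctor.obj x) :=
    Functor.congr_obj congr(($(sq.isPushout.w)).toFunctor) ((a, x) : A × X)
  have hlr (b : B) (x : X) (a : A) (y : Y) (h : (b, g.toFunctor.obj x) = (f.toFunctor.obj a, y)) :
      sq.inl.toFunctor.obj (b, x) = sq.inr.toFunctor.obj (a, y) := by
    obtain ⟨rfl, rfl⟩ := Prod.mk.inj h
    exact hw a x
  intro p q h
  obtain ⟨⟨b, x⟩, rfl⟩ | ⟨⟨a, y⟩, rfl⟩ := exists_obj_eq_of_isPushout sq.isPushout p <;>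
    obtain ⟨⟨b', x'⟩, rfl⟩ | ⟨⟨a', y'⟩, rfl⟩ := exists_obj_eq_of_isPushout sq.isPushout q
  · obtain ⟨rfl, h'⟩ := Prod.mk.inj ((hl b x).symm.trans (h.trans (hl b' x')))
    rw [hg h']
  · exact hlr _ _ _ _ ((hl b x).symm.trans (h.trans (hr a' y')))
  · exact (hlr _ _ _ _ ((hl b' x').symm.trans (h.symm.trans (hr a y)))).symm
  · obtain ⟨h', rfl⟩ := Prod.mk.inj ((hr a y).symm.trans (h.trans (hr a' y')))
    rw [hf h']

lemma cof_whiskerRight {A B : Cat.{u, u}} {f : A ⟶ B} (hf : cof f) (X : Cat.{u, u}) :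
    cof (f ▷ X) := fun (p q : A × X) h ↦ by
  have h' : (f.toFunctor.obj p.1, p.2) = (f.toFunctor.obj q.1, q.2) := h
  exact Prod.ext (hf (Prod.mk.inj h').1) (Prod.mk.inj h').2

lemma cof_whiskerLeft {A B : Cat.{u, u}} {f : A ⟶ B} (hf : cof f) (X : Cat.{u, u}) :
    cof (X ◁ f) := fun (p q : X × A) h ↦ by
  have h' : (p.1, f.toFunctor.obj p.2) = (q.1, f.toFunctor.obj q.2) := h
  exact Prod.ext (Prod.mk.inj h').1 (hf (Prod.mk.inj h').2)

/-- Currying commutes with precomposition. -/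
def whiskeringLeftProdCompCurryIso {A B : Type*} [Category* A] [Category* B] (F : A ⥤ B)
    (X Z : Type*) [Category* X] [Category* Z] :
    (whiskeringLeft (A × X) (B × X) Z).obj (F.prod (𝟭 X)) ⋙ curry ≅
      curry ⋙ (whiskeringLeft A B (X ⥤ Z)).obj F :=
  NatIso.ofComponents (fun T ↦ NatIso.ofComponents (fun a ↦ NatIso.ofComponents
    (fun x ↦ Iso.refl _)))

/-- By currying, testing `f ▷ X` against `Z` amounts to testing `f` against `X ⥤ Z`, which is again
a groupoid. -/
lemma weq_whiskerRight {A B : Cat.{u, u}} {f : A ⟶ B} (hf : weq f) (X : Cat.{u, u}) :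
    weq (f ▷ X) := fun Z _ ↦ by
  let _ : Groupoid (X ⥤ Z) := Groupoid.ofIsIso (fun α ↦ NatIso.isIso_of_isIso_app α)
  have : ((whiskeringLeft A B (X ⥤ Z)).obj f.toFunctor).IsEquivalence := hf (X ⥤ Z)
  have : (curry : (A × X ⥤ Z) ⥤ A ⥤ X ⥤ Z).IsEquivalence := currying.isEquivalence_inverse
  have : (curry : (B × X ⥤ Z) ⥤ B ⥤ X ⥤ Z).IsEquivalence := currying.isEquivalence_inverse
  have := isEquivalence_of_iso (whiskeringLeftProdCompCurryIso f.toFunctor X Z).symm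
  exact isEquivalence_of_comp_right
    ((whiskeringLeft (A × X) (B × X) Z).obj (f.toFunctor.prod (𝟭 X))) curry

lemma weq_whiskerLeft {A B : Cat.{u, u}} {f : A ⟶ B} (hf : weq f) (X : Cat.{u, u}) :
    weq (X ◁ f) := by
  have h : X ◁ f = (β_ X A).hom ≫ f ▷ X ≫ (β_ B X).hom := by simp
  rw [h]
  have (P Q : Cat.{u, u}) : weq (β_ P Q).hom := by
    have : (β_ P Q).hom.toFunctor.IsEquivalence := (Cat.equivOfIso (β_ P Q)).isEquivalence_functor
    exact weq_of_isEquivalence _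
  exact weq.comp_mem _ _ (this _ _) (weq.comp_mem _ _ (weq_whiskerRight hf X) (this _ _))

attribute [local instance] modelCategory

/-- Trivial cofibrations form the left class of a weak factorization system, and any class defined
by a left lifting property is stable under cobase change. -/
lemma trivialCofibrations_isStableUnderCobaseChange :
    (cof.{u} ⊓ weq.{u}).IsStableUnderCobaseChange := by
  have : (fibrations Cat.{u, u}).llp = trivialCofibrations Cat.{u, u} :=
    MorphismProperty.llp_eq_of_wfs _ _
  have : fib.{u}.llp = cof.{u} ⊓ weq.{u} := this
  rw [← this]
  infer_instance

lemma isCartesianClosedModelCategory : IsCartesianClosedModelCategory Cat.{u, u} where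
  -- The initial category has no objects, since it maps to the empty category.
  isCofibrant_unit := ⟨fun x ↦
    ((Limits.initial.to (Cat.of (Discrete PEmpty.{u + 1}))).toFunctor.obj x).as.elim⟩
  cofibration_pushoutProduct f g sq hf hg := ⟨cof_pushoutProduct sq hf.mem hg.mem⟩
  weakEquivalence_pushoutProduct_left {A B X Y} f g sq hf hg hf' := ⟨by
    have := trivialCofibrations_isStableUnderCobaseChange.{u}
    -- `sq.inr` is a cobase change of `f ▷ X`, and `sq.inr ≫ sq.ι` is `f ▷ Y`; two-out-of-three
    -- gives `sq.ι`.
    have h : (cof ⊓ weq) sq.inr := MorphismProperty.of_isPushout sq.isPushout.flip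
      ⟨cof_whiskerRight hf.mem X, weq_whiskerRight hf'.mem X⟩
    refine weq.of_precomp sq.inr sq.ι h.2 ?_
    rw [sq.inr_ι]
    exact weq_whiskerRight hf'.mem Y⟩
  weakEquivalence_pushoutProduct_right {A B X Y} f g sq hf hg hg' := ⟨by
    have := trivialCofibrations_isStableUnderCobaseChange.{u}
    have h : (cof ⊓ weq) sq.inl := MorphismProperty.of_isPushout sq.isPushout
      ⟨cof_whiskerLeft hg.mem A, weq_whiskerLeft hg'.mem A⟩
    refine weq.of_precomp sq.inl sq.ι h.2 ?_
    rw [sq.inl_ι]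
    exact weq_whiskerLeft hg'.mem B⟩

end GroupoidalCat

/-- The functors that are injective on objects, the groupoidal equivalences and the path
fibrations are the cofibrations, weak equivalences and fibrations of a model structure on the
category of small categories, and this model structure is cartesian closed. -/
theorem mainTheorem11 :
    ∃ _ : ModelCategory Cat.{u, u},
      cofibrations Cat.{u, u} = GroupoidalCat.cof.{u} ∧
      weakEquivalences Cat.{u, u} = GroupoidalCat.weq.{u} ∧
      fibrations Cat.{u, u} = GroupoidalCat.fib.{u} ∧
      IsCartesianClosedModelCategory Cat.{u, u} :=
  ⟨GroupoidalCat.modelCategory, rfl, rfl, rfl, GroupoidalCat.isCartesianClosedModelCategory⟩
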